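/- **Theorem 3.** *Notation.* Let $F_3$ be the $3\times3$ matrix $(F_3)_{nm}=\frac1{\sqrt3}e^{-\frac{2\pi i}{3}(n+\frac12)(m+\frac12)}$, $n,m\in\{0,1,2\}$, let $|0\rangle,|1\rangle,|2\rangle$ be the standard basis of $\mathbb C^3$, and let $$f_-=\tfrac1{\sqrt2}(1,0,-1),\quad f_+=\tfrac1{\sqrt6}(1,2,1),\quad \lambda_-=1,\quad \lambda_+=\lambda=\tfrac{i}{\sqrt3}.$$ *Eigenstates.* Let $k\ge1$ and let $\eta=\eta_1\cdots\eta_k\in\{+,-\}^k$, with indices extended $k$-periodically. Let $\tau\eta=\eta_2\cdots\eta_k\eta_1$ be the cyclic shift, $\ell$ the minimal period of $\eta$ under $\tau$, $d$ the number of symbols $+$ in $\eta$, $\delta=d/k$, and $|\eta\rangle=f_{\eta_1}\otimes\cdots\otimes f_{\eta_k}\in(\mathbb C^3)^{\otimes k}$. For an integer $m\ge0$ put $z=\lambda^{\delta}e^{2\pi i m/\ell}$ (principal branch), $$c_{jm}=\prod_{s=1}^{j}\frac{\lambda_{\eta_s}}{z},\qquad \mathcal N=\sum_{j=0}^{\ell-1}|c_{jm}|^2,\qquad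 \Psi^m_\eta=\frac1{\sqrt{\mathcal N}}\sum_{j=0}^{\ell-1}c_{jm}\,|\tau^j\eta\rangle$$ (neither $|c_{jm}|$ nor $\mathcal N$ depends on $m$). *Husimi weights.* For $0\le b\le k$, $\alpha\in\{0,1,2\}^b$ and $\alpha'\in\{0,1,2\}^{k-b}$, the Walsh–Husimi weight of $\psi\in(\mathbb C^3)^{\otimes k}$ on the quantum rectangle $[\alpha'\cdot\alpha]$ is $$H^b_\psi([\alpha'\cdot\alpha])=\big|\big\langle\psi,\ |\alpha_1\rangle\otimes\cdots\otimes|\alpha_b\rangle\otimes F_3^\dagger|\alpha'_{k-b}\rangle\otimes\cdots\otimes F_3^\dagger|\alpha'_1\rangle\big\rangle\big|^2 .$$ For $v\ge1$, $\epsilon,\epsilon'\in\{0,1,2\}^v$ and $v\le b\le k-v$, the weight $H^b_\psi([\epsilon'\cdot\epsilon]_v)$ of the $v$-square $[\epsilon'\cdot\epsilon]_v$ is the sum of $H^b_\psi([\alpha'\cdot\alpha])$ over all quantum rectangles contained in it, i.e. over all $\alpha,\alpha'$ whose first $v$ digits are those of $\epsilon$ and $\epsilon'$ respectively. *The measure $\rho_{[\eta]}$.*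 It is the product $\rho_{[\eta]}=\nu_{\rm Can}(dp)\times\nu_{[\eta]}(dq)$, with weights $\rho_{[\eta]}([\epsilon'\cdot\epsilon]_v)=\nu_{\rm Can}([\epsilon'])\,\nu_{[\eta]}([\epsilon])$, where $\nu_{\rm Can}([\epsilon'])=2^{-v}$ if no digit of $\epsilon'$ equals $1$ and $0$ otherwise, and $$\nu_{[\eta]}([\epsilon])=\frac1{\mathcal N}\sum_{j=0}^{\ell-1}|c_{j0}|^2\prod_{i=1}^{v}|\langle\epsilon_i|f_{\eta_{i+j}}\rangle|^2 .$$ *Claim.* For every $v\ge1$ there is a constant $C_v$ such that for every $v$-square $[\epsilon'\cdot\epsilon]_v$, every $k\ge1$, every $\eta\in\{+,-\}^k$, every $m\in\{0,\dots,k-1\}$ and every $b$ with $v\le b\le k-v$, $$\Big|H^b_{\Psi^m_\eta}([\epsilon'\cdot\epsilon]_v)-\rho_{[\eta]}([\epsilon'\cdot\epsilon]_v)\Big|\le\frac{C_v}{k}.$$ In particular the constant is independent of $\eta$, $m$ and $b$. -/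

import Mathlib

/-!
Walsh quantization of the open triadic baker map: states, Walsh coherent states, Walsh-Husimi
weights, the eigenstates attached to binary sequences, and the associated measures.

Digits are elements of `Fin 3`; a binary sequence is `η : Fin k → Bool` with `true` for `+` and
`false` for `-`. All indices start at `0`, so the entry `η_s` with `s = 1, …, k` is `η (s - 1)`.
-/

noncomputable section

namespace WalshBaker

/-- The `3 × 3` Fourier matrix with half-integer shifts. -/
def F3 : Matrix (Fin 3) (Fin 3) ℂ :=
  Matrix.of fun n m =>
    (1 / (Real.sqrt 3 : ℂ)) *
      Complex.exp (-(2 * Real.pi * Complex.I / 3) * (((n : ℕ) : ℂ) + 1 / 2) *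
        (((m : ℕ) : ℂ) + 1 / 2))

/-- The vectors `f_+ = (1, 2, 1) / √6` (for `true`) and `f_- = (1, 0, -1) / √2` (for `false`). -/
def f : Bool → EuclideanSpace ℂ (Fin 3)
  | true => (1 / (Real.sqrt 6 : ℂ)) • !₂[1, 2, 1]
  | false => (1 / (Real.sqrt 2 : ℂ)) • !₂[1, 0, -1]

/-- The number `λ = i / √3`. -/
def lam : ℂ := Complex.I / (Real.sqrt 3 : ℂ)

/-- The eigenvalues `λ_+ = λ` and `λ_- = 1`. -/
def eig : Bool → ℂ
  | true => lam
  | false => 1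

/-- The quantum Hilbert space `(ℂ³)^{⊗ k}`, in the position basis indexed by digit strings. -/
abbrev State (k : ℕ) : Type := EuclideanSpace ℂ (Fin k → Fin 3)

/-- The product state `u_1 ⊗ ⋯ ⊗ u_k`. -/
def tensor {k : ℕ} (u : Fin k → EuclideanSpace ℂ (Fin 3)) : State k :=
  WithLp.toLp 2 fun x => ∏ i, u i (x i)

/-- The position vector `|e⟩` of `ℂ³`. -/
def posVec (e : Fin 3) : EuclideanSpace ℂ (Fin 3) := EuclideanSpace.single e 1

/-- The momentum vector `F_3† |e⟩` of `ℂ³`. -/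
def momVec (e : Fin 3) : EuclideanSpace ℂ (Fin 3) := WithLp.toLp 2 fun a => F3.conjTranspose a e

/-- The Walsh coherent state of the quantum rectangle `[α' · α]` of size `b × (k - b)`:
`|α_1⟩ ⊗ ⋯ ⊗ |α_b⟩ ⊗ F_3†|α'_{k-b}⟩ ⊗ ⋯ ⊗ F_3†|α'_1⟩`. -/
def coherent {k b : ℕ} (α' : Fin (k - b) → Fin 3) (α : Fin b → Fin 3) : State k :=
  tensor fun i =>
    if h : (i : ℕ) < b then posVec (α ⟨i, h⟩)
    else momVec (α' ⟨k - 1 - (i : ℕ), by have := i.isLt; omega⟩)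

/-- The weight `H^b_ψ([α' · α])` of a quantum rectangle of size `b × (k - b)`. -/
def husimi {k : ℕ} (b : ℕ) (ψ : State k) (α' : Fin (k - b) → Fin 3) (α : Fin b → Fin 3) : ℝ :=
  ‖inner ℂ ψ (coherent α' α)‖ ^ 2

/-- The weight `H^b_ψ([ε' · ε]_v)` of a `v`-square: the sum of the weights of all quantum
rectangles of size `b × (k - b)` contained in it. A quantum rectangle `[α' · α]` is contained in
`[ε' · ε]_v` when its first `v` position digits are `ε` and its first `v` momentum digits
are `ε'`. -/
def husimiSquare {k v : ℕ} (b : ℕ) (hb : v ≤ b) (hb' : v ≤ k - b) (ψ : State k)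
    (ε' ε : Fin v → Fin 3) : ℝ :=
  ∑ α' : Fin (k - b) → Fin 3, ∑ α : Fin b → Fin 3,
    if (∀ i : Fin v, α' (Fin.castLE hb' i) = ε' i) ∧ (∀ i : Fin v, α (Fin.castLE hb i) = ε i)
    then husimi b ψ α' α else 0

section Sequences

variable {k : ℕ} [NeZero k]

/-- The `k`-periodic extension of a sequence of length `k`. -/
def ext (η : Fin k → Bool) (i : ℕ) : Bool := η (Fin.ofNat k i)

/-- The cyclic shift `τ(η_1 η_2 ⋯ η_k) = η_2 ⋯ η_k η_1`. -/
def tau (η : Fin k → Bool) : Fin k → Bool := fun i => ext η ((i : ℕ) + 1)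

/-- The minimal period `ℓ` of `η` under the cyclic shift. -/
def period (η : Fin k → Bool) : ℕ := Function.minimalPeriod tau η

/-- The relative degree `δ = d / k`, where `d` is the number of symbols `+` in `η`. -/
def relDegree (η : Fin k → Bool) : ℝ :=
  ((Finset.univ.filter fun i => η i = true).card : ℝ) / k

/-- The number `z_{δ, m/ℓ} = λ^δ exp(2πi m/ℓ)` (principal branch). -/
def z (η : Fin k → Bool) (m : ℕ) : ℂ :=
  lam ^ (relDegree η : ℂ) * Complex.exp (2 * Real.pi * Complex.I * m / period η)

/-- The coefficients `c_{jm} = ∏_{s=1}^{j} λ_{η_s} / z_{δ, m/ℓ}`. -/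
def c (η : Fin k → Bool) (m j : ℕ) : ℂ := ∏ s ∈ Finset.range j, eig (ext η s) / z η m

/-- The normalization `𝒩 = ∑_{j < ℓ} |c_{jm}|²`. -/
def normalization (η : Fin k → Bool) (m : ℕ) : ℝ :=
  ∑ j ∈ Finset.range (period η), ‖c η m j‖ ^ 2

/-- The state `|η⟩ = f_{η_1} ⊗ ⋯ ⊗ f_{η_k}`. -/
def ket (η : Fin k → Bool) : State k := tensor fun i => f (η i)

/-- The eigenstate `Ψ^m_η = 𝒩^{-1/2} ∑_{j < ℓ} c_{jm} |τ^j η⟩`. -/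
def Psi (η : Fin k → Bool) (m : ℕ) : State k :=
  (1 / (Real.sqrt (normalization η m) : ℂ)) •
    ∑ j ∈ Finset.range (period η), c η m j • ket (tau^[j] η)

/-- The weights of the uniform measure on the Cantor set on triadic intervals. -/
def nuCan {n : ℕ} (ε : Fin n → Fin 3) : ℝ := if ∀ i, ε i ≠ 1 then (1 / 2) ^ n else 0

/-- The weights of the probability measure `ν_[η]` on triadic intervals:
`𝒩^{-1} ∑_{j < ℓ} |c_{j0}|² ∏_i |⟨ε_i | f_{η_{i+j}}⟩|²`, indices of `η` extended by periodicity. -/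
def nu (η : Fin k → Bool) {n : ℕ} (ε : Fin n → Fin 3) : ℝ :=
  (normalization η 0)⁻¹ * ∑ j ∈ Finset.range (period η),
    ‖c η 0 j‖ ^ 2 * ∏ i : Fin n, ‖inner ℂ (posVec (ε i)) (f (ext η ((i : ℕ) + j)))‖ ^ 2

/-- The weight `ρ_[η]([ε' · ε])` of the product measure `ρ_[η] = ν_Can(dp) × ν_[η](dq)`. -/
def rho (η : Fin k → Bool) {n' n : ℕ} (ε' : Fin n' → Fin 3) (ε : Fin n → Fin 3) : ℝ :=
  nuCan ε' * nu η ε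

end Sequences

end WalshBaker

end

open scoped ComplexConjugate

namespace WalshBaker

/-! Expanding the squared modulus turns the weight of a `v`-square into 𝒩⁻¹ times a double sum over
pairs of shifts j, j', with a kernel that is a product over the k tensor factors. The square fixes
only the first v and last v digits; at every other factor the sum runs over a full orthonormal basis
and, f₊ and f₋ being orthonormal, gives 1 if the two symbols agree and 0 otherwise. The diagonal j =
j' is exactly ρ: since v ≤ b ≤ k - v, the first v digits are positions and the last v momenta, and
|⟨f_s, F₃†a⟩|² does not depend on s. The error is therefore carried by pairs of distinct shifts that
agree on the window [v, k - v).

Two facts bound it. Counting: as in the Morse–Hedlund theorem, at least min(ℓ, n + 1) windows of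
length n occur, so at most 4v shifts share their window with another one (`card_partnered_le`), and
if any does then ℓ > k - 2v. Size: |c_j| is |λ| to the power of a discrepancy, which can be large in
general; but one coincidence makes the word almost invariant under translation by j' - j, and this
bounds all oscillations of the discrepancy in terms of v alone (`abs_disc_sub_le`). Then all |c_j|
are comparable, each |c_j|² is O(𝒩/ℓ), and Cauchy–Schwarz over the few exceptional shifts gives
O(𝒩/k) (`sum_agree_le`). -/

/-! ### Counting itineraries of a finite system -/

/-- The itinerary of length `n` of a point under `T`, read off by the observable `π`. -/
def itinerary {X A : Type*} (T : X → X) (π : X → A) (n : ℕ) (x : X) : Fin n → A :=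
  fun i => π (T^[i] x)

/-- If the observable separates points of a finite invariant set, then the number of itineraries
of length `n` is at least `n + 1`, until it reaches the cardinality of the set. -/
theorem min_card_le_card_image_itinerary {X A : Type*} [DecidableEq A] {T : X → X} {π : X → A}
    {s : Finset X} (hs : s.Nonempty) (hT : ∀ x ∈ s, T x ∈ s)
    (hsep : ∀ x ∈ s, ∀ y ∈ s, (∀ n, π (T^[n] x) = π (T^[n] y)) → x = y) (n : ℕ) :
    min s.card (n + 1) ≤ (s.image (itinerary T π n)).card := by
  induction n with
  | zero =>
    have : 0 < (s.image (itinerary T π 0)).card := (hs.image _).card_pos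
    omega
  | succ n ih =>
    have hproj : (s.image (itinerary T π (n + 1))).image (fun w (i : Fin n) => w i.castSucc) =
        s.image (itinerary T π n) := by
      rw [Finset.image_image]; rfl
    have hle : (s.image (itinerary T π n)).card ≤ (s.image (itinerary T π (n + 1))).card := by
      rw [← hproj]; exact Finset.card_image_le
    by_contra! hlt
    have heq : (s.image (itinerary T π n)).card = (s.image (itinerary T π (n + 1))).card := by
      omega
    -- Equal counts make forgetting the last symbol injective on itineraries: n symbols determine
    -- the next one and, by iteration, all later ones.
    rw [← hproj, Finset.card_image_iff] at heq
    have step : ∀ x ∈ s, ∀ y ∈ s, itinerary T π n x = itinerary T π n y →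
        itinerary T π (n + 1) x = itinerary T π (n + 1) y := by
      intro x hx y hy h
      apply heq
      · simpa using ⟨x, hx, rfl⟩
      · simpa using ⟨y, hy, rfl⟩
      · exact h
    have iter : ∀ m, ∀ x ∈ s, ∀ y ∈ s, itinerary T π n x = itinerary T π n y →
        itinerary T π n (T^[m] x) = itinerary T π n (T^[m] y) := by
      intro m
      induction m with
      | zero => intro x _ y _ h; exact h
      | succ m ihm =>
        intro x hx y hy h
        refine ihm (T x) (hT x hx) (T y) (hT y hy) ?_
        have h1 := step x hx y hy h
        ext i
        exact congrFun h1 i.succ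
    have hmem : ∀ m, ∀ x ∈ s, T^[m] x ∈ s := by
      intro m
      induction m with
      | zero => intro x hx; exact hx
      | succ m ihm => intro x hx; exact ihm _ (hT x hx)
    have hinj : Set.InjOn (itinerary T π (n + 1)) s := by
      intro x hx y hy h
      refine hsep x hx y hy fun m => ?_
      have h0 : itinerary T π n x = itinerary T π n y := by
        ext i; exact congrFun h i.castSucc
      have h1 := step _ (hmem m x hx) _ (hmem m y hy) (iter m x hx y hy h0)
      exact congrFun h1 0
    rw [Finset.card_image_of_injOn hinj] at hlt
    omega

/-- The number of points that share their image with another point. -/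
theorem card_filter_exists_ne_le {X Y : Type*} [DecidableEq X] [DecidableEq Y] (s : Finset X)
    (Φ : X → Y) :
    (s.filter fun x => ∃ y ∈ s, y ≠ x ∧ Φ y = Φ x).card ≤ 2 * (s.card - (s.image Φ).card) := by
  set J := s.filter fun x => ∃ y ∈ s, y ≠ x ∧ Φ y = Φ x with hJ
  have h1 : J.card = ∑ w ∈ s.image Φ, (J.filter fun x => Φ x = w).card := by
    refine Finset.card_eq_sum_card_fiberwise fun x hx => ?_
    exact Finset.mem_coe.2 (Finset.mem_image_of_mem _ (Finset.mem_filter.1 hx).1)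
  have h2 := Finset.card_eq_sum_card_image Φ s
  have h3 : J.card + 2 * (s.image Φ).card ≤ 2 * s.card := by
    rw [h1, h2, Finset.mul_sum, mul_comm, ← smul_eq_mul, ← Finset.sum_const,
      ← Finset.sum_add_distrib]
    refine Finset.sum_le_sum fun w hw => ?_
    obtain ⟨x, hx, rfl⟩ := Finset.mem_image.1 hw
    have hpos : 0 < (s.filter fun y => Φ y = Φ x).card :=
      Finset.card_pos.2 ⟨x, by simp [hx]⟩
    have hsub : (J.filter fun y => Φ y = Φ x) ⊆ s.filter fun y => Φ y = Φ x :=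
      Finset.filter_subset_filter _ (Finset.filter_subset _ _)
    have hcard := Finset.card_le_card hsub
    rcases (J.filter fun y => Φ y = Φ x).eq_empty_or_nonempty with h | ⟨y, hy⟩
    · rw [h, Finset.card_empty]; omega
    · simp only [hJ, Finset.mem_filter] at hy
      obtain ⟨⟨hys, y', hy's, hne, hyy⟩, hyx⟩ := hy
      have : 1 < (s.filter fun y => Φ y = Φ x).card :=
        Finset.one_lt_card.2 ⟨y, by simp [hys, hyx], y', by simp [hy's, hyy, hyx], hne.symm⟩
      omega
  omega

/-! ### Bounded oscillation on a cyclic group -/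

/-- Bounded discrepancy: if the second difference of `S` in the directions `1` and `r` is nonzero
but supported on an arc of length `w`, then the oscillation of `S` is bounded in terms of `w`. -/
theorem abs_sub_le_of_second_difference {k : ℕ} [NeZero k] (S : ZMod k → ℝ) (r a : ZMod k) (w : ℕ)
    (hw : w ≤ k) (hS : ∀ p, |S (p + 1) - S p| ≤ 1)
    (h1 : ∀ p, |(S (p + r + 1) - S (p + r)) - (S (p + 1) - S p)| ≤ 1)
    (h0 : ∀ i : ℕ, i < k - w → S (a + i + r + 1) - S (a + i + r) = S (a + i + 1) - S (a + i))
    (hne : ∃ p, S (p + r + 1) - S (p + r) ≠ S (p + 1) - S p) (p q : ZMod k) :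
    |S q - S p| ≤ 2 * (w : ℝ) ^ 2 + w := by
  have hval : ∀ p : ZMod k, ∃ i : ℕ, i < k ∧ p = a + i := fun p =>
    ⟨(p - a).val, ZMod.val_lt _, by rw [ZMod.natCast_zmod_val]; ring⟩
  set n := addOrderOf r with hn
  have hnpos : 0 < n := addOrderOf_pos r
  -- the set of multiples of `r` meets every short interval
  obtain ⟨D, hD0, hDw, hDr⟩ : ∃ D : ℕ, 0 < D ∧ D < w ∧ (D : ZMod k) ∈ AddSubgroup.zmultiples r := by
    obtain ⟨p, hp⟩ := hne
    set h : ZMod k → ℝ := fun p => (S (p + r + 1) - S (p + r)) - (S (p + 1) - S p) with hh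
    -- The sum telescopes around the coset of `p`, so a nonzero value at `p` has a companion in the
    -- same coset. Both lie in the arc of length `w`, and their difference yields `D`.
    have hsum : ∑ u ∈ Finset.range n, h (p + u • r) = 0 := by
      have := Finset.sum_range_sub (fun u : ℕ => S (p + u • r + 1) - S (p + u • r)) n
      rw [hn, addOrderOf_nsmul_eq_zero, zero_smul, sub_self] at this
      rw [← this]
      refine Finset.sum_congr rfl fun u _ => ?_
      simp only [hh, succ_nsmul, add_assoc]
    obtain ⟨u, hu0, hun, hu⟩ : ∃ u, 0 < u ∧ u < n ∧ h (p + u • r) ≠ 0 := by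
      by_contra! hcon
      rw [Finset.sum_eq_single_of_mem 0 (Finset.mem_range.2 hnpos)] at hsum
      · rw [zero_smul, add_zero] at hsum
        exact hp (sub_eq_zero.1 hsum)
      · intro u hu hu'
        exact hcon u (Nat.pos_of_ne_zero hu') (Finset.mem_range.1 hu)
    obtain ⟨i, hi, hpi⟩ := hval p
    obtain ⟨i', hi', hpi'⟩ := hval (p + u • r)
    have hik : k - w ≤ i := by
      by_contra! hlt
      exact hp (by rw [hpi]; exact h0 i hlt)
    have hik' : k - w ≤ i' := by
      by_contra! hlt
      exact hu (by rw [hpi']; exact sub_eq_zero.2 (h0 i' hlt))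
    have hur : u • r ≠ 0 := fun h => by
      have := addOrderOf_dvd_of_nsmul_eq_zero h
      exact absurd (Nat.le_of_dvd hu0 this) (by omega)
    have hdiff : u • r = (i' : ZMod k) - i := by
      have : a + i + u • r = a + i' := by rw [← hpi, hpi']
      linear_combination this
    have hurmem : u • r ∈ AddSubgroup.zmultiples r :=
      AddSubgroup.nsmul_mem _ (AddSubgroup.mem_zmultiples r) u
    rcases lt_trichotomy i i' with hlt | heq | hgt
    · refine ⟨i' - i, by omega, by omega, ?_⟩
      rw [Nat.cast_sub hlt.le, ← hdiff]; exact hurmem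
    · exact absurd (by rw [hdiff, heq, sub_self]) hur
    · refine ⟨i - i', by omega, by omega, ?_⟩
      rw [Nat.cast_sub hgt.le, ← neg_sub, ← hdiff]; exact AddSubgroup.neg_mem _ hurmem
  -- the increments over steps of length `r` are constant off an arc
  set R : ZMod k → ℝ := fun p => S (p + r) - S p with hR
  set c := R a with hc
  have hRstep : ∀ p, |R (p + 1) - R p| ≤ 1 := fun p => by
    have := h1 p
    simp only [hR]
    rwa [show S (p + 1 + r) - S (p + 1) - (S (p + r) - S p) =
      S (p + r + 1) - S (p + r) - (S (p + 1) - S p) by rw [add_right_comm]; ring]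
  have hRconst : ∀ i : ℕ, i ≤ k - w → R (a + i) = c := by
    intro i
    induction i with
    | zero => intro _; simp [hc]
    | succ i ih =>
      intro hi
      rw [← ih (by omega)]
      have := h0 i (by omega)
      simp only [hR, Nat.cast_succ]
      rw [← add_assoc, add_right_comm (a + (i : ZMod k)) 1 r]
      linarith
  have hRarc : ∀ i : ℕ, |R (a + (k - w : ℕ) + i) - c| ≤ i := by
    intro i
    induction i with
    | zero => simp [hRconst (k - w) le_rfl]
    | succ i ih =>
      have := hRstep (a + (k - w : ℕ) + i)
      rw [Nat.cast_succ, ← add_assoc]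
      push_cast
      calc _ ≤ _ + _ := abs_sub_le _ (R (a + (k - w : ℕ) + i)) c
        _ ≤ _ := by linarith
  have hsumE : ∑ q, |R q - c| ≤ (w : ℝ) ^ 2 := by
    have hsub : ∑ q, |R q - c| ≤
        ∑ q ∈ (Finset.range w).image (fun i : ℕ => a + (k - w : ℕ) + i), |R q - c| := by
      refine (Finset.sum_subset (Finset.subset_univ _) fun q _ hq => ?_).ge
      obtain ⟨i, hi, rfl⟩ := hval q
      have : i ≤ k - w := by
        by_contra! hlt
        refine hq (Finset.mem_image.2 ⟨i - (k - w), Finset.mem_range.2 (by omega), ?_⟩)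
        rw [Nat.cast_sub hlt.le]; ring
      rw [hRconst i this, sub_self, abs_zero]
    refine hsub.trans ((Finset.sum_le_card_nsmul _ _ (w : ℝ) ?_).trans ?_)
    · intro q hq
      obtain ⟨i, hi, rfl⟩ := Finset.mem_image.1 hq
      exact (hRarc i).trans (by exact_mod_cast (Finset.mem_range.1 hi).le)
    · have : ((Finset.range w).image (fun i : ℕ => a + (k - w : ℕ) + (i : ZMod k))).card ≤ w :=
        Finset.card_image_le.trans (Finset.card_range w).le
      rw [nsmul_eq_mul, sq]
      gcongr
  -- The points of an orbit are distinct, so each deviation of `R` from `c` is counted at most once: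
  -- `S` grows linearly along the orbit up to w².
  have horbit : ∀ (p : ZMod k) (t : ℕ), t ≤ n →
      |S (p + t • r) - S p - t * c| ≤ (w : ℝ) ^ 2 := by
    intro p t ht
    have htel := Finset.sum_range_sub (fun u : ℕ => S (p + u • r)) t
    have : S (p + t • r) - S p - t * c = ∑ u ∈ Finset.range t, (R (p + u • r) - c) := by
      rw [Finset.sum_sub_distrib, Finset.sum_const, Finset.card_range, nsmul_eq_mul t c]
      simp only [zero_smul, add_zero] at htel
      rw [← htel]
      simp only [hR, succ_nsmul, add_assoc]
    rw [this]
    refine (Finset.abs_sum_le_sum_abs _ _).trans (le_trans ?_ hsumE)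
    rw [← Finset.sum_image (f := fun q => |R q - c|) (g := fun u : ℕ => p + u • r)]
    · exact Finset.sum_le_sum_of_subset_of_nonneg (Finset.subset_univ _)
        fun _ _ _ => abs_nonneg _
    · intro u hu u' hu' huu
      have hu := Finset.mem_range.1 hu
      have hu' := Finset.mem_range.1 hu'
      exact nsmul_injOn_Iio_addOrderOf (x := r) (Set.mem_Iio.2 (by omega))
        (Set.mem_Iio.2 (by omega)) (add_left_cancel huu)
  -- After `n` steps the orbit closes up, which forces the slope to be small.
  have hnc : (n : ℝ) * |c| ≤ (w : ℝ) ^ 2 := by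
    have := horbit a n le_rfl
    rwa [hn, addOrderOf_nsmul_eq_zero, add_zero, sub_self, zero_sub, abs_neg, abs_mul,
      Nat.abs_cast] at this
  have hmult : ∀ (p x : ZMod k), x ∈ AddSubgroup.zmultiples r →
      |S (p + x) - S p| ≤ 2 * (w : ℝ) ^ 2 := by
    intro p x hx
    rw [mem_zmultiples_iff_mem_range_addOrderOf] at hx
    obtain ⟨t, ht, rfl⟩ := Finset.mem_image.1 hx
    have ht := (Finset.mem_range.1 ht).le
    have h2 := horbit p t ht
    have h3 : |(t : ℝ) * c| ≤ (w : ℝ) ^ 2 := by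
      rw [abs_mul, Nat.abs_cast]
      refine le_trans ?_ hnc
      gcongr
    calc |S (p + t • r) - S p| = |(S (p + t • r) - S p - t * c) + t * c| := by ring_nf
      _ ≤ _ := abs_add_le _ _
      _ ≤ _ := by linarith
  have hsteps : ∀ (p : ZMod k) (i : ℕ), |S (p + i) - S p| ≤ i := by
    intro p i
    induction i with
    | zero => simp
    | succ i ih =>
      have := hS (p + i)
      rw [Nat.cast_succ, ← add_assoc]
      push_cast
      calc _ ≤ _ + _ := abs_sub_le _ (S (p + i)) _
        _ ≤ _ := by linarith
  set y := (q - p).val with hy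
  -- The multiple of `D` stays in the subgroup generated by `r` and costs 2w²; the remainder is
  -- fewer than `w` unit steps.
  have hq : q = p + ((y / D : ℕ) • (D : ZMod k)) + (y % D : ℕ) := by
    rw [nsmul_eq_mul, add_assoc, ← Nat.cast_mul, ← Nat.cast_add, mul_comm, Nat.div_add_mod, hy,
      ZMod.natCast_zmod_val]
    ring
  have hA := hmult p ((y / D : ℕ) • (D : ZMod k)) (AddSubgroup.nsmul_mem _ hDr _)
  have hB := hsteps (p + ((y / D : ℕ) • (D : ZMod k))) (y % D)
  rw [← hq] at hB
  have hC : ((y % D : ℕ) : ℝ) ≤ w := by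
    exact_mod_cast (Nat.mod_lt y hD0).le.trans hDw.le
  calc |S q - S p| ≤ _ + _ := abs_sub_le _ (S (p + ((y / D : ℕ) • (D : ZMod k)))) _
    _ ≤ _ := by linarith

/-! ### Cyclic shifts, coefficients and discrepancy -/

theorem norm_lam : ‖lam‖ = (Real.sqrt 3)⁻¹ := by
  rw [lam, norm_div, Complex.norm_I, Complex.norm_real, Real.norm_of_nonneg (Real.sqrt_nonneg _),
    one_div]

theorem norm_lam_pos : 0 < ‖lam‖ := by
  rw [norm_lam]; positivity

theorem norm_lam_le_one : ‖lam‖ ≤ 1 := by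
  rw [norm_lam]
  exact inv_le_one_of_one_le₀ (Real.one_le_sqrt.2 (by norm_num))

theorem relDegree_nonneg {k : ℕ} (η : Fin k → Bool) : 0 ≤ relDegree η := by
  rw [relDegree]; positivity

theorem relDegree_le_one {k : ℕ} (η : Fin k → Bool) : relDegree η ≤ 1 := by
  rw [relDegree]
  refine div_le_one_of_le₀ ?_ (Nat.cast_nonneg k)
  exact_mod_cast (Finset.card_le_univ _).trans (Fintype.card_fin k).le

section Sequences

variable {k : ℕ} [NeZero k]

theorem ext_periodic (η : Fin k → Bool) : Function.Periodic (ext η) k := fun i => by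
  simp [ext, Fin.ofNat]

theorem ext_val (η : Fin k → Bool) (i : Fin k) : ext η i = η i := by
  simp [ext]

theorem ext_mod (η : Fin k → Bool) (i : ℕ) : ext η (i % k) = ext η i :=
  (ext_periodic η).map_mod_nat i

theorem ext_tau (η : Fin k → Bool) (i : ℕ) : ext (tau η) i = ext η (i + 1) := by
  change ext η (i % k + 1) = _
  rw [← ext_mod, Nat.mod_add_mod, ext_mod]

theorem ext_tau_iterate (η : Fin k → Bool) (j i : ℕ) : ext (tau^[j] η) i = ext η (i + j) := by
  induction j generalizing i with
  | zero => rfl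
  | succ j ih => rw [Function.iterate_succ_apply', ext_tau, ih, add_right_comm, add_assoc]

theorem tau_iterate_apply (η : Fin k → Bool) (j : ℕ) (i : Fin k) :
    (tau^[j] η) i = ext η (i + j) := by
  rw [← ext_val (tau^[j] η) i, ext_tau_iterate]

theorem tau_iterate_length (η : Fin k → Bool) : tau^[k] η = η := by
  funext i
  rw [tau_iterate_apply, ext_periodic, ext_val]

theorem isPeriodicPt_tau (η : Fin k → Bool) : Function.IsPeriodicPt tau k η :=
  tau_iterate_length η

theorem period_pos (η : Fin k → Bool) : 0 < period η :=
  (isPeriodicPt_tau η).minimalPeriod_pos (NeZero.pos k)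

theorem period_le (η : Fin k → Bool) : period η ≤ k :=
  (isPeriodicPt_tau η).minimalPeriod_le (NeZero.pos k)

theorem injOn_tau_iterate (η : Fin k → Bool) :
    Set.InjOn (fun j => tau^[j] η) (Finset.range (period η)) := by
  rw [Finset.coe_range]
  exact Function.iterate_injOn_Iio_minimalPeriod

theorem tau_iterate_eq_of_ext_eq {η : Fin k → Bool} {j j' : ℕ}
    (h : ∀ i, ext η (i + j) = ext η (i + j')) : tau^[j] η = tau^[j'] η := by
  funext i
  rw [tau_iterate_apply, tau_iterate_apply, h]

/-- The indicator of the symbol `+`, as a real number. -/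
noncomputable def ind (s : Bool) : ℝ := if s then 1 else 0

/-- The discrepancy of the initial segment of length `j` of a sequence. -/
noncomputable def disc (η : Fin k → Bool) (j : ℕ) : ℝ := ∑ s ∈ Finset.range j, (ind (ext η s) - relDegree η)

theorem norm_eig (s : Bool) : ‖eig s‖ = ‖lam‖ ^ ind s := by
  cases s <;> simp [eig, ind]

theorem norm_z (η : Fin k → Bool) (m : ℕ) : ‖z η m‖ = ‖lam‖ ^ relDegree η := by
  have hexp : 2 * Real.pi * Complex.I * m / period η =
      ((2 * Real.pi * m / period η : ℝ) : ℂ) * Complex.I := by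
    push_cast; ring
  rw [z, norm_mul, hexp, Complex.norm_exp_ofReal_mul_I, mul_one, Complex.norm_cpow_real]

/-- The phase indexed by `m` has modulus 1 and drops out; comparing coefficients becomes comparing
discrepancies. -/
theorem norm_c (η : Fin k → Bool) (m j : ℕ) : ‖c η m j‖ = ‖lam‖ ^ disc η j := by
  rw [c, norm_prod, disc, Real.rpow_sum_of_pos norm_lam_pos]
  refine Finset.prod_congr rfl fun s _ => ?_
  rw [norm_div, norm_eig, norm_z, Real.rpow_sub norm_lam_pos]

theorem normalization_eq (η : Fin k → Bool) (m : ℕ) : normalization η m = normalization η 0 := by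
  simp only [normalization, norm_c]

theorem normalization_pos (η : Fin k → Bool) (m : ℕ) : 0 < normalization η m := by
  refine Finset.sum_pos (fun j _ => ?_) ⟨0, Finset.mem_range.2 (period_pos η)⟩
  rw [norm_c]
  have := norm_lam_pos
  positivity

/-- Subtracting the mean makes the sum over k symbols vanish, so the discrepancy descends to `ZMod
k`. -/
theorem disc_periodic (η : Fin k → Bool) : Function.Periodic (disc η) k := fun j => by
  have hk : (k : ℝ) ≠ 0 := Nat.cast_ne_zero.2 (NeZero.ne k)
  have h0 : disc η k = 0 := by
    rw [disc, Finset.sum_sub_distrib, Finset.sum_const, Finset.card_range, nsmul_eq_mul, relDegree,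
      mul_div_cancel₀ _ hk, Finset.sum_range, Finset.card_filter]
    simp [ext_val, ind]
  rw [disc, add_comm, Finset.sum_range_add, ← disc, h0, zero_add, disc]
  refine Finset.sum_congr rfl fun s _ => ?_
  rw [add_comm, ext_periodic]

theorem disc_succ (η : Fin k → Bool) (j : ℕ) :
    disc η (j + 1) - disc η j = ind (ext η j) - relDegree η := by
  rw [disc, Finset.sum_range_succ, ← disc, add_sub_cancel_left]

/-- If two distinct shifts of a sequence agree off the first and last `v` symbols, then the
discrepancies of the sequence are bounded in terms of `v`. -/
theorem abs_disc_sub_le {η : Fin k → Bool} {v j j' : ℕ} (hv : 2 * v ≤ k)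
    (hj : j < period η) (hj' : j' < period η) (hne : j ≠ j')
    (hagree : ∀ i, v ≤ i → i < k - v → ext η (i + j) = ext η (i + j')) (p q : ℕ) :
    |disc η q - disc η p| ≤ 2 * ((2 * v : ℕ) : ℝ) ^ 2 + (2 * v : ℕ) := by
  set S : ZMod k → ℝ := fun p => disc η p.val with hS
  have hScast : ∀ i : ℕ, S i = disc η i := fun i => by
    simp only [hS, ZMod.val_natCast, (disc_periodic η).map_mod_nat]
  have hstep : ∀ i : ℕ, S (i + 1) - S i = ind (ext η i) - relDegree η := fun i => by
    rw [← Nat.cast_succ, hScast, hScast, disc_succ]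
  have hlift : ∀ p : ZMod k, ∃ i : ℕ, p = i := fun p => ⟨p.val, (ZMod.natCast_zmod_val p).symm⟩
  have hind : ∀ s, 0 ≤ ind s ∧ ind s ≤ 1 := fun s => by cases s <;> simp [ind]
  have hind_inj : ∀ s s', ind s = ind s' → s = s' := fun s s' => by
    cases s <;> cases s' <;> simp [ind]
  have hδ0 := relDegree_nonneg η
  have hδ1 := relDegree_le_one η
  -- Starting at `j + v` puts the window of agreement first; the exceptional arc consists of the
  -- last `v` and first `v` symbols, joined cyclically.
  have key := abs_sub_le_of_second_difference S ((j' : ZMod k) - j) ((j : ZMod k) + v) (2 * v) hv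
    ?_ ?_ ?_ ?_ p q
  · rwa [hScast, hScast] at key
  · intro p
    obtain ⟨i, rfl⟩ := hlift p
    rw [hstep, abs_le]
    have := hind (ext η i)
    constructor <;> linarith
  · intro p
    obtain ⟨i, rfl⟩ := hlift p
    obtain ⟨i', hi'⟩ := hlift ((i : ZMod k) + ((j' : ZMod k) - j))
    rw [hi', hstep, hstep, abs_le]
    have h1 := hind (ext η i)
    have h2 := hind (ext η i')
    constructor <;> linarith
  · intro i hi
    have h1 : (j : ZMod k) + v + i + ((j' : ZMod k) - j) = ((v + i + j' : ℕ) : ZMod k) := by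
      push_cast; ring
    have h2 : (j : ZMod k) + v + i = ((v + i + j : ℕ) : ZMod k) := by
      push_cast; ring
    rw [h1, h2, hstep, hstep, hagree (v + i) (by omega) (by omega)]
  -- Equal increments everywhere would make the two shifts coincide, although both exponents are
  -- below the minimal period.
  · by_contra! hcon
    refine hne (injOn_tau_iterate η (by simpa using hj) (by simpa using hj')
      (tau_iterate_eq_of_ext_eq fun i => ?_))
    have h := hcon ((i + j : ℕ) : ZMod k)
    have h1 : ((i + j : ℕ) : ZMod k) + ((j' : ZMod k) - j) = ((i + j' : ℕ) : ZMod k) := by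
      push_cast; ring
    rw [h1, hstep, hstep] at h
    exact hind_inj _ _ (by linarith)

/-! ### Shifts with a common middle window -/

/-- Two shifts agree off the first and last `v` symbols. -/
def Agree (η : Fin k → Bool) (v j j' : ℕ) : Prop :=
  ∀ i, v ≤ i → i < k - v → ext η (i + j) = ext η (i + j')

/-- Observing the symbol at index `v` instead of 0 aligns the itinerary with the window. -/
theorem agree_iff_itinerary (η : Fin k → Bool) (v j j' : ℕ) :
    Agree η v j j' ↔ itinerary tau (fun ξ => ext ξ v) (k - 2 * v) (tau^[j] η) =
      itinerary tau (fun ξ => ext ξ v) (k - 2 * v) (tau^[j'] η) := by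
  simp only [funext_iff, itinerary, ext_tau_iterate]
  constructor
  · intro h i
    have := h (v + i) (by omega) (by omega)
    exact this
  · intro h i hi hi'
    have := h ⟨i - v, by omega⟩
    simpa [Nat.add_sub_cancel' hi] using this

theorem min_period_le_card_image (η : Fin k → Bool) (v n : ℕ) (hv : v ≤ k) :
    min (period η) (n + 1) ≤ ((Finset.range (period η)).image fun j =>
      itinerary tau (fun ξ => ext ξ v) n (tau^[j] η)).card := by
  have h := min_card_le_card_image_itinerary (T := tau) (π := fun ξ : Fin k → Bool => ext ξ v)
    (s := (Finset.range (period η)).image fun j => tau^[j] η)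
    ⟨η, Finset.mem_image.2 ⟨0, Finset.mem_range.2 (period_pos η), rfl⟩⟩ ?_ ?_ n
  · rwa [Finset.card_image_of_injOn (injOn_tau_iterate η), Finset.card_range,
      Finset.image_image] at h
  · intro x hx
    obtain ⟨j, -, rfl⟩ := Finset.mem_image.1 hx
    refine Finset.mem_image.2 ⟨(j + 1) % period η, Finset.mem_range.2
      (Nat.mod_lt _ (period_pos η)), ?_⟩
    rw [period, Function.iterate_mod_minimalPeriod_eq, Function.iterate_succ_apply']
  · intro x _ y _ hxy
    funext i
    -- At this time the symbol of index `k + i`, equal to that of index `i`, is under observation.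
    have := hxy (k - v + i)
    simp only [ext_tau_iterate] at this
    rw [← add_assoc, Nat.add_sub_cancel' hv, add_comm, ext_periodic, ext_periodic, ext_val,
      ext_val] at this
    exact this

open Classical in
/-- The shifts which agree with another one off the first and last `v` symbols. -/
noncomputable def partnered (η : Fin k → Bool) (v : ℕ) : Finset ℕ :=
  (Finset.range (period η)).filter fun j =>
    ∃ j' ∈ Finset.range (period η), j' ≠ j ∧ Agree η v j' j

theorem card_partnered_le_sub (η : Fin k → Bool) (v : ℕ) (hv : 2 * v ≤ k) :
    (partnered η v).card ≤ 2 * (period η - min (period η) (k - 2 * v + 1)) := by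
  have h1 := card_filter_exists_ne_le (Finset.range (period η)) fun j =>
    itinerary tau (fun ξ => ext ξ v) (k - 2 * v) (tau^[j] η)
  have h2 := min_period_le_card_image η v (k - 2 * v) (by omega)
  have h3 : partnered η v = (Finset.range (period η)).filter fun x =>
      ∃ y ∈ Finset.range (period η), y ≠ x ∧
        itinerary tau (fun ξ => ext ξ v) (k - 2 * v) (tau^[y] η) =
          itinerary tau (fun ξ => ext ξ v) (k - 2 * v) (tau^[x] η) := by
    simp only [partnered, agree_iff_itinerary]
  rw [← h3, Finset.card_range] at h1
  omega

theorem card_partnered_le (η : Fin k → Bool) (v : ℕ) (hv : 2 * v ≤ k) :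
    (partnered η v).card ≤ 4 * v := by
  have h1 := card_partnered_le_sub η v hv
  have h2 := period_le η
  omega

theorem lt_period_of_partnered {η : Fin k → Bool} {v : ℕ} (hv : 2 * v ≤ k)
    (h : (partnered η v).Nonempty) : k - 2 * v < period η := by
  have h1 := card_partnered_le_sub η v hv
  have h2 := h.card_pos
  omega

end Sequences

/-! ### Weight of the off-diagonal pairs -/

section OffDiagonal

variable {k : ℕ} [NeZero k]

/-- The bound on the oscillation of the discrepancy of a sequence with partnered shifts. -/
noncomputable def discBound (v : ℕ) : ℝ := 2 * ((2 * v : ℕ) : ℝ) ^ 2 + (2 * v : ℕ)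

-- Both members of an agreeing pair are partnered; enlarging the sum to all pairs of partnered
-- shifts makes it factor.
open Classical in
theorem sum_agree_le_sq (η : Fin k → Bool) (v m : ℕ) :
    ∑ j ∈ Finset.range (period η), ∑ j' ∈ Finset.range (period η),
      (if j ≠ j' ∧ Agree η v j j' then ‖c η m j‖ * ‖c η m j'‖ else 0) ≤
    (∑ j ∈ partnered η v, ‖c η m j‖) ^ 2 := by
  rw [sq, Finset.sum_mul_sum, ← Finset.sum_product', ← Finset.sum_product', ← Finset.sum_filter]
  refine Finset.sum_le_sum_of_subset_of_nonneg (fun x hx => ?_) fun _ _ _ => by positivity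
  simp only [Finset.mem_filter, Finset.mem_product, partnered] at hx ⊢
  obtain ⟨⟨h1, h2⟩, hne, hag⟩ := hx
  exact ⟨⟨h1, x.2, h2, hne.symm, fun i hi hi' => (hag i hi hi').symm⟩, h2, x.1, h1, hne, hag⟩

open Classical in
/-- The total weight of the pairs of distinct shifts that agree off the first and last `v` symbols
is a fraction of order `1 / k` of the normalization. -/
theorem sum_agree_le (η : Fin k → Bool) (v m : ℕ) (hv : 2 * v ≤ k) :
    ∑ j ∈ Finset.range (period η), ∑ j' ∈ Finset.range (period η),
      (if j ≠ j' ∧ Agree η v j j' then ‖c η m j‖ * ‖c η m j'‖ else 0) ≤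
    32 * (v : ℝ) ^ 2 * ‖lam‖ ^ (-(2 * discBound v)) / k * normalization η m := by
  refine (sum_agree_le_sq η v m).trans ?_
  have hk : (0 : ℝ) < k := Nat.cast_pos.2 (NeZero.pos k)
  have hl := norm_lam_pos
  have hN := (normalization_pos η m).le
  have hB : 0 ≤ discBound v := by rw [discBound]; positivity
  have hM : 1 ≤ ‖lam‖ ^ (-(2 * discBound v)) :=
    Real.one_le_rpow_of_pos_of_le_one_of_nonpos hl norm_lam_le_one (by linarith)
  set M := ‖lam‖ ^ (-(2 * discBound v)) with hMdef
  have hcard : ((partnered η v).card : ℝ) ≤ 4 * v := by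
    exact_mod_cast card_partnered_le η v hv
  rcases (partnered η v).eq_empty_or_nonempty with hP | hP
  · rw [hP, Finset.sum_empty, zero_pow two_ne_zero]
    positivity
  have hsub : partnered η v ⊆ Finset.range (period η) := Finset.filter_subset _ _
  refine (sq_sum_le_card_mul_sum_sq (s := partnered η v) (f := fun j => ‖c η m j‖)).trans ?_
  rw [div_mul_eq_mul_div, le_div_iff₀ hk]
  -- For small `k` the factor `k` is absorbed in the constant. Otherwise a single pair already gives
  -- ℓ > k - 2v > k/2.
  rcases le_or_gt k (4 * v) with hkv | hkv
  · have h1 : ∑ j ∈ partnered η v, ‖c η m j‖ ^ 2 ≤ normalization η m :=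
      Finset.sum_le_sum_of_subset_of_nonneg hsub fun _ _ _ => by positivity
    have h2 : (k : ℝ) ≤ 4 * v := by exact_mod_cast hkv
    calc _ ≤ (4 * (v : ℝ)) * normalization η m * (4 * v) := by gcongr
      _ = 16 * (v : ℝ) ^ 2 * 1 * normalization η m := by ring
      _ ≤ 32 * (v : ℝ) ^ 2 * M * normalization η m := by gcongr; norm_num
  · obtain ⟨j₀, hj₀⟩ := hP
    have hlt := lt_period_of_partnered hv ⟨j₀, hj₀⟩
    have hk2 : (k : ℝ) ≤ 2 * period η := by exact_mod_cast (by omega : k ≤ 2 * period η)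
    simp only [partnered, Finset.mem_filter, Finset.mem_range] at hj₀
    obtain ⟨hj, j', hj', hne, hag⟩ := hj₀
    have hosc := abs_disc_sub_le hv hj' hj hne hag
    -- Since |λ| ≤ 1, bounded oscillation gives |c_j|² ≤ M |c_i|² for every i; summing over i
    -- produces the normalization.
    have hmax : ∀ j, period η * ‖c η m j‖ ^ 2 ≤ M * normalization η m := by
      intro j
      rw [normalization, Finset.mul_sum, ← nsmul_eq_mul]
      conv_lhs => rw [← Finset.card_range (period η)]
      rw [← Finset.sum_const]
      refine Finset.sum_le_sum fun i _ => ?_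
      rw [norm_c, norm_c, ← Real.rpow_natCast, ← Real.rpow_natCast, ← Real.rpow_mul hl.le,
        ← Real.rpow_mul hl.le, hMdef, ← Real.rpow_add hl]
      refine Real.rpow_le_rpow_of_exponent_ge hl norm_lam_le_one ?_
      have := (abs_le.1 (hosc j i)).2
      rw [← discBound] at this
      push_cast
      linarith
    have h1 : period η * ∑ j ∈ partnered η v, ‖c η m j‖ ^ 2 ≤ 4 * v * (M * normalization η m) := by
      rw [Finset.mul_sum]
      refine (Finset.sum_le_card_nsmul _ _ _ fun j _ => hmax j).trans ?_
      rw [nsmul_eq_mul]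
      gcongr
    have h2 : 0 ≤ ∑ j ∈ partnered η v, ‖c η m j‖ ^ 2 := by positivity
    calc _ ≤ (4 * (v : ℝ)) * (∑ j ∈ partnered η v, ‖c η m j‖ ^ 2) * (2 * period η) := by gcongr
      _ = 8 * v * (period η * ∑ j ∈ partnered η v, ‖c η m j‖ ^ 2) := by ring
      _ ≤ 8 * v * (4 * v * (M * normalization η m)) := by gcongr
      _ = _ := by ring

end OffDiagonal

/-! ### Amplitudes of f₊ and f₋ in the position and momentum bases -/

section Amplitudes

theorem inner_f_posVec (s : Bool) (a : Fin 3) : inner ℂ (f s) (posVec a) = conj (f s a) := by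
  simp [posVec, EuclideanSpace.inner_single_right]

theorem conj_f (s : Bool) (a : Fin 3) : conj (f s a) = f s a := by
  cases s <;> fin_cases a <;> simp [f, Complex.conj_ofNat]

theorem ofReal_sqrt_sq {x : ℝ} (hx : 0 ≤ x) : ((Real.sqrt x : ℝ) : ℂ) ^ 2 = x := by
  rw [← Complex.ofReal_pow, Real.sq_sqrt hx]

theorem inner_f_momVec (s : Bool) (a : Fin 3) :
    inner ℂ (f s) (momVec a) = ∑ x, conj (F3 a x) * f s x := by
  rw [PiLp.inner_apply]
  refine Finset.sum_congr rfl fun x _ => ?_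
  rw [RCLike.inner_apply, conj_f]
  simp [momVec]

/-- The base is exp(iπ/6); the half-integer shifts make both factors of the exponent odd. -/
theorem conj_F3_apply (n m : Fin 3) :
    conj (F3 n m) = (1 / (Real.sqrt 3 : ℂ)) *
      (Real.sqrt 3 / 2 + Complex.I / 2) ^ ((2 * (n : ℕ) + 1) * (2 * (m : ℕ) + 1)) := by
  have h : (Real.sqrt 3 / 2 + Complex.I / 2 : ℂ) = Complex.exp ((Real.pi / 6 : ℝ) * Complex.I) := by
    rw [Complex.exp_mul_I, ← Complex.ofReal_cos, ← Complex.ofReal_sin, Real.cos_pi_div_six,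
      Real.sin_pi_div_six]
    push_cast; ring
  rw [h, ← Complex.exp_nat_mul]
  simp only [F3, Matrix.of_apply, map_mul, ← Complex.exp_conj, map_div₀, map_one,
    Complex.conj_ofReal, map_neg, map_add, map_ofNat, Complex.conj_I, map_natCast]
  congr 2
  push_cast
  ring

theorem root_pow_three : (Real.sqrt 3 / 2 + Complex.I / 2 : ℂ) ^ 3 = Complex.I := by
  have h3 := ofReal_sqrt_sq (x := 3) (by norm_num)
  have hI := Complex.I_sq
  push_cast at h3
  linear_combination (Real.sqrt 3 / 8 + 3 / 8 * Complex.I) * h3 +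
    (3 / 8 * Real.sqrt 3 + Complex.I / 8) * hI

theorem root_pow_five : (Real.sqrt 3 / 2 + Complex.I / 2 : ℂ) ^ 5 =
    -Real.sqrt 3 / 2 + Complex.I / 2 := by
  have h3 := ofReal_sqrt_sq (x := 3) (by norm_num)
  have hI := Complex.I_sq
  push_cast at h3
  rw [pow_succ, pow_succ, root_pow_three]
  linear_combination Complex.I / 4 * h3 + (Real.sqrt 3 / 2 + Complex.I / 4) * hI

/-- The conjugate of the Fourier matrix, in algebraic form. -/
theorem conj_F3 (n m : Fin 3) : conj (F3 n m) = (1 / (Real.sqrt 3 : ℂ)) *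
    !![Real.sqrt 3 / 2 + Complex.I / 2, Complex.I, -Real.sqrt 3 / 2 + Complex.I / 2;
      Complex.I, -Complex.I, Complex.I;
      -Real.sqrt 3 / 2 + Complex.I / 2, Complex.I, Real.sqrt 3 / 2 + Complex.I / 2] n m := by
  rw [conj_F3_apply]
  congr 1
  have h3 := root_pow_three
  have h5 := root_pow_five
  set w : ℂ := Real.sqrt 3 / 2 + Complex.I / 2 with hw
  have h9 : w ^ 9 = -Complex.I := by
    rw [show w ^ 9 = (w ^ 3) ^ 3 by ring, h3, Complex.I_pow_three]
  have h15 : w ^ 15 = Complex.I := by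
    rw [show w ^ 15 = (w ^ 3) ^ 4 * w ^ 3 by ring, h3, Complex.I_pow_four, one_mul]
  have h25 : w ^ 25 = w := by
    rw [show w ^ 25 = (w ^ 3) ^ 4 * (w ^ 3) ^ 4 * w by ring, h3, Complex.I_pow_four, one_mul,
      one_mul]
  fin_cases n <;> fin_cases m <;> simp [h3, h5, h9, h15, h25]

theorem inner_f_momVec_true (a : Fin 3) :
    inner ℂ (f true) (momVec a) = if a = 1 then 0 else Complex.I / (Real.sqrt 2 : ℂ) := by
  have h3 := ofReal_sqrt_sq (x := 3) (by norm_num)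
  push_cast at h3
  have h6 : (Real.sqrt 6 : ℂ) = Real.sqrt 2 * Real.sqrt 3 := by
    rw [← Complex.ofReal_mul, ← Real.sqrt_mul (by norm_num)]; norm_num
  have h2' : (Real.sqrt 2 : ℂ) ≠ 0 := by simp
  have h3' : (Real.sqrt 3 : ℂ) ≠ 0 := by simp
  rw [inner_f_momVec, Fin.sum_univ_three]
  simp only [conj_F3]
  fin_cases a
  · simp [f, h6]
    field_simp
    linear_combination (-2 * Complex.I) * h3
  · simp [f, h6]
    field_simp
    ring
  · simp [f, h6]
    field_simp
    linear_combination (-2 * Complex.I) * h3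

theorem inner_f_momVec_false (a : Fin 3) :
    inner ℂ (f false) (momVec a) =
      if a = 1 then 0 else if a = 0 then 1 / (Real.sqrt 2 : ℂ) else -1 / (Real.sqrt 2 : ℂ) := by
  have h2' : (Real.sqrt 2 : ℂ) ≠ 0 := by simp
  have h3' : (Real.sqrt 3 : ℂ) ≠ 0 := by simp
  rw [inner_f_momVec, Fin.sum_univ_three]
  simp only [conj_F3]
  fin_cases a
  · simp [f]
    field_simp
    ring
  · simp [f]
  · simp [f]
    field_simp
    ring

/-- Independence of `s` is what makes the momentum marginal ν_Can for every η. -/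
theorem norm_sq_inner_f_momVec (s : Bool) (a : Fin 3) :
    ‖inner ℂ (f s) (momVec a)‖ ^ 2 = if a ≠ 1 then 1 / 2 else 0 := by
  cases s
  · rw [inner_f_momVec_false]
    fin_cases a <;> simp [abs_of_nonneg]
  · rw [inner_f_momVec_true]
    fin_cases a <;> simp [abs_of_nonneg]

theorem sum_inner_f_momVec (s s' : Bool) :
    ∑ a, inner ℂ (f s) (momVec a) * conj (inner ℂ (f s') (momVec a)) =
      if s = s' then 1 else 0 := by
  have h2 := ofReal_sqrt_sq (x := 2) (by norm_num)
  have h2' : (Real.sqrt 2 : ℂ) ≠ 0 := by simp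
  rw [Fin.sum_univ_three]
  cases s <;> cases s' <;>
    simp [inner_f_momVec_false, inner_f_momVec_true] <;> field_simp <;> simp [h2] <;> norm_num

theorem sum_inner_f_posVec (s s' : Bool) :
    ∑ a, inner ℂ (f s) (posVec a) * conj (inner ℂ (f s') (posVec a)) =
      if s = s' then 1 else 0 := by
  have h2 := ofReal_sqrt_sq (x := 2) (by norm_num)
  have h6 := ofReal_sqrt_sq (x := 6) (by norm_num)
  have h2' : (Real.sqrt 2 : ℂ) ≠ 0 := by simp
  have h6' : (Real.sqrt 6 : ℂ) ≠ 0 := by simp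
  rw [Fin.sum_univ_three]
  cases s <;> cases s' <;>
    simp only [inner_f_posVec, conj_f] <;> simp [f] <;> field_simp <;> simp [h2, h6] <;> norm_num

/-- The amplitude of `f s` on the `i`-th factor of the coherent state with `i`-th digit `a`. -/
noncomputable def amp (b i : ℕ) (s : Bool) (a : Fin 3) : ℂ :=
  inner ℂ (f s) (if i < b then posVec a else momVec a)

theorem sum_amp (b i : ℕ) (s s' : Bool) :
    ∑ a, amp b i s a * conj (amp b i s' a) = if s = s' then 1 else 0 := by
  unfold amp
  split_ifs with hi hs hs
  · rw [sum_inner_f_posVec, if_pos hs]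
  · rw [sum_inner_f_posVec, if_neg hs]
  · rw [sum_inner_f_momVec, if_pos hs]
  · rw [sum_inner_f_momVec, if_neg hs]

theorem norm_amp_le_one (b i : ℕ) (s : Bool) (a : Fin 3) : ‖amp b i s a‖ ≤ 1 := by
  have h := sum_amp b i s s
  simp only [Complex.mul_conj', if_true] at h
  have h' : ∑ a, ‖amp b i s a‖ ^ 2 = 1 := by exact_mod_cast h
  have h1 : ‖amp b i s a‖ ^ 2 ≤ 1 := h' ▸ Finset.single_le_sum
    (f := fun a => ‖amp b i s a‖ ^ 2) (fun _ _ => by positivity) (Finset.mem_univ a)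
  exact (sq_le_one_iff₀ (norm_nonneg _)).1 h1

theorem inner_tensor {k : ℕ} (u w : Fin k → EuclideanSpace ℂ (Fin 3)) :
    inner ℂ (tensor u) (tensor w) = ∏ i, inner ℂ (u i) (w i) := by
  simp only [PiLp.inner_apply]
  rw [Finset.prod_univ_sum, Fintype.piFinset_univ]
  refine Finset.sum_congr rfl fun x _ => ?_
  simp [tensor, Finset.prod_mul_distrib]

end Amplitudes

/-! ### The projector on a square, factor by factor -/

section Kernel

variable {k v : ℕ}

/-- The digits allowed at the `i`-th factor by the `v`-square `[ε' · ε]`. -/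
def allowed (k : ℕ) (ε' ε : Fin v → Fin 3) (i : ℕ) : Finset (Fin 3) :=
  if h : i < v then {ε ⟨i, h⟩}
  else if h' : k - 1 - i < v then {ε' ⟨k - 1 - i, h'⟩} else Finset.univ

/-- The matrix element, between two symbols, of the projector on the allowed digits. -/
noncomputable def localKernel (k b : ℕ) (ε' ε : Fin v → Fin 3) (i : ℕ) (s s' : Bool) : ℂ :=
  ∑ a ∈ allowed k ε' ε i, amp b i s a * conj (amp b i s' a)

/-- No digit is constrained here, so Parseval reduces the kernel to the orthonormality of f₊ and f₋.
-/
theorem localKernel_of_middle (b : ℕ) (ε' ε : Fin v → Fin 3) {i : ℕ} (hi : v ≤ i)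
    (hi' : i < k - v) (s s' : Bool) :
    localKernel k b ε' ε i s s' = if s = s' then 1 else 0 := by
  rw [localKernel, allowed, dif_neg (by omega), dif_neg (by omega), sum_amp]

theorem norm_localKernel_le_one (b : ℕ) (ε' ε : Fin v → Fin 3) (i : ℕ) (s s' : Bool) :
    ‖localKernel k b ε' ε i s s'‖ ≤ 1 := by
  have h : ∀ a, ‖amp b i s a * conj (amp b i s' a)‖ ≤ 1 := fun a => by
    rw [norm_mul, RCLike.norm_conj]
    exact mul_le_one₀ (norm_amp_le_one ..) (norm_nonneg _) (norm_amp_le_one ..)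
  rw [localKernel, allowed]
  split_ifs
  · simpa using h _
  · simpa using h _
  · rw [sum_amp]; split_ifs <;> simp

theorem localKernel_self_of_lt (b : ℕ) (hb : v ≤ b) (ε' ε : Fin v → Fin 3) (i : Fin v) (s : Bool) :
    localKernel k b ε' ε i s s = ((‖inner ℂ (posVec (ε i)) (f s)‖ ^ 2 : ℝ) : ℂ) := by
  rw [localKernel, allowed, dif_pos i.isLt, Finset.sum_singleton, Complex.mul_conj', amp,
    if_pos (i.isLt.trans_le hb), norm_inner_symm]
  push_cast
  rfl

theorem localKernel_self_of_ge (b : ℕ) (hb : v ≤ b) (hb' : v ≤ k - b) (ε' ε : Fin v → Fin 3)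
    (i : Fin v) (s : Bool) :
    localKernel k b ε' ε (k - 1 - i) s s = ((if ε' i ≠ 1 then 1 / 2 else 0 : ℝ) : ℂ) := by
  have hi := i.isLt
  have h : k - 1 - (k - 1 - (i : ℕ)) = i := by omega
  rw [localKernel, allowed, dif_neg (by omega), dif_pos (by omega), Finset.sum_singleton,
    Complex.mul_conj', amp, if_neg (by omega), ← norm_sq_inner_f_momVec s]
  simp only [h]
  push_cast
  rfl

theorem nuCan_eq_prod (ε : Fin v → Fin 3) : nuCan ε = ∏ i, if ε i ≠ 1 then (1 / 2 : ℝ) else 0 := by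
  rw [Finset.prod_ite_zero]
  simp [nuCan]

variable [NeZero k]

/-- The matrix element, between two shifts of `η`, of the projector on the `v`-square. -/
noncomputable def kernel (η : Fin k → Bool) (b : ℕ) (ε' ε : Fin v → Fin 3) (j j' : ℕ) : ℂ :=
  ∏ i : Fin k, localKernel k b ε' ε i (ext η (i + j)) (ext η (i + j'))

theorem norm_kernel_le_one (η : Fin k → Bool) (b : ℕ) (ε' ε : Fin v → Fin 3) (j j' : ℕ) :
    ‖kernel η b ε' ε j j'‖ ≤ 1 := by
  rw [kernel, norm_prod]
  exact Finset.prod_le_one (fun _ _ => norm_nonneg _) fun _ _ => norm_localKernel_le_one ..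

theorem kernel_eq_zero {η : Fin k → Bool} (b : ℕ) (ε' ε : Fin v → Fin 3) {j j' : ℕ}
    (h : ¬ Agree η v j j') : kernel η b ε' ε j j' = 0 := by
  simp only [Agree, not_forall] at h
  obtain ⟨i, hi, hi', hne⟩ := h
  refine Finset.prod_eq_zero (Finset.mem_univ (⟨i, by omega⟩ : Fin k)) ?_
  rw [localKernel_of_middle b ε' ε hi hi', if_neg hne]

theorem kernel_self (η : Fin k → Bool) (b : ℕ) (hb : v ≤ b) (hb' : v ≤ k - b)
    (ε' ε : Fin v → Fin 3) (hk : 2 * v ≤ k) (j : ℕ) :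
    kernel η b ε' ε j j =
      ((nuCan ε' * ∏ i : Fin v, ‖inner ℂ (posVec (ε i)) (f (ext η (i + j)))‖ ^ 2 : ℝ) : ℂ) := by
  set φ : ℕ → ℂ := fun i => localKernel k b ε' ε i (ext η (i + j)) (ext η (i + j)) with hφ
  have h1 : kernel η b ε' ε j j = ∏ i ∈ Finset.range k, φ i := (Finset.prod_range φ).symm
  have h2 : ∏ i ∈ Finset.range k, φ i = (∏ i ∈ Finset.range (k - v), φ i) *
      ∏ i ∈ Finset.range v, φ (k - v + i) := by
    rw [← Finset.prod_range_add, Nat.sub_add_cancel (by omega)]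
  have h3 : ∏ i ∈ Finset.range (k - v), φ i = ∏ i ∈ Finset.range v, φ i := by
    refine (Finset.prod_subset (Finset.range_subset_range.2 (by omega)) fun i hi hi' => ?_).symm
    rw [Finset.mem_range] at hi hi'
    simp only [hφ]
    rw [localKernel_of_middle b ε' ε (by omega) hi, if_pos rfl]
  have h4 : ∏ i ∈ Finset.range v, φ i =
      ((∏ i : Fin v, ‖inner ℂ (posVec (ε i)) (f (ext η (i + j)))‖ ^ 2 : ℝ) : ℂ) := by
    rw [Finset.prod_range, Complex.ofReal_prod]
    exact Finset.prod_congr rfl fun i _ => localKernel_self_of_lt b hb ε' ε i _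
  have h5 : ∏ i ∈ Finset.range v, φ (k - v + i) = ((nuCan ε' : ℝ) : ℂ) := by
    -- Momentum digits are read from the right end, hence the reflection.
    rw [← Finset.prod_range_reflect, Finset.prod_range, nuCan_eq_prod, Complex.ofReal_prod]
    refine Finset.prod_congr rfl fun i _ => ?_
    have hi := i.isLt
    have : k - v + (v - 1 - i) = k - 1 - i := by omega
    rw [this]
    exact localKernel_self_of_ge b hb hb' ε' ε i _
  rw [h1, h2, h3, h4, h5, Complex.ofReal_mul, mul_comm]

end Kernel

/-! ### Expansion of the Husimi weights over pairs of shifts -/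

section Expansion

variable {k v : ℕ}

/-- A pair of momentum and position digits of a quantum rectangle, as a string of `k` digits. -/
def digitsEquiv (k b : ℕ) (hb : b ≤ k) :
    (Fin k → Fin 3) ≃ (Fin (k - b) → Fin 3) × (Fin b → Fin 3) where
  toFun ω := (fun i => ω ⟨k - 1 - i, by omega⟩, fun i => ω ⟨i, by omega⟩)
  invFun p i := if h : (i : ℕ) < b then p.2 ⟨i, h⟩ else p.1 ⟨k - 1 - i, by omega⟩
  left_inv ω := by
    funext i
    dsimp only
    split_ifs with h
    · rfl
    · congr 1
      apply Fin.ext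
      dsimp only
      omega
  right_inv p := by
    ext i : 2
    · have hi := i.isLt
      dsimp only
      rw [dif_neg (by omega)]
      exact congrArg p.1 (Fin.ext (by dsimp only; omega))
    · simp

theorem coherent_digitsEquiv (b : ℕ) (hb : b ≤ k) (ω : Fin k → Fin 3) :
    coherent (digitsEquiv k b hb ω).1 (digitsEquiv k b hb ω).2 =
      tensor fun i : Fin k => if (i : ℕ) < b then posVec (ω i) else momVec (ω i) := by
  unfold coherent
  congr 1
  funext i
  split_ifs with h
  · rfl
  · simp only [digitsEquiv, Equiv.coe_fn_mk]
    congr 2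
    apply Fin.ext
    dsimp only
    omega

theorem mem_square_iff (b : ℕ) (hb : v ≤ b) (hb' : v ≤ k - b) (hbk : b ≤ k)
    (ε' ε : Fin v → Fin 3) (ω : Fin k → Fin 3) :
    ((∀ i : Fin v, (digitsEquiv k b hbk ω).1 (Fin.castLE hb' i) = ε' i) ∧
      (∀ i : Fin v, (digitsEquiv k b hbk ω).2 (Fin.castLE hb i) = ε i)) ↔
    ω ∈ Fintype.piFinset fun i : Fin k => allowed k ε' ε i := by
  simp only [digitsEquiv, Equiv.coe_fn_mk, Fintype.mem_piFinset, Fin.val_castLE]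
  constructor
  · rintro ⟨h1, h2⟩ i
    rw [allowed]
    split_ifs with h h'
    · rw [Finset.mem_singleton]
      exact h2 ⟨i, h⟩
    · rw [Finset.mem_singleton, ← h1]
      congr 1
      apply Fin.ext
      dsimp only
      omega
    · exact Finset.mem_univ _
  · intro h
    refine ⟨fun i => ?_, fun i => ?_⟩
    · have hi := i.isLt
      have h1 := h ⟨k - 1 - i, by omega⟩
      rw [allowed, dif_neg (by dsimp only; omega), dif_pos (by dsimp only; omega),
        Finset.mem_singleton] at h1
      rw [h1]
      congr 1
      apply Fin.ext
      dsimp only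
      omega
    · have hi := i.isLt
      have h1 := h ⟨i, by omega⟩
      rw [allowed, dif_pos hi, Finset.mem_singleton] at h1
      exact h1

theorem husimiSquare_eq_sum (b : ℕ) (hb : v ≤ b) (hb' : v ≤ k - b) (hbk : b ≤ k) (ψ : State k)
    (ε' ε : Fin v → Fin 3) :
    husimiSquare b hb hb' ψ ε' ε =
      ∑ ω ∈ Fintype.piFinset fun i : Fin k => allowed k ε' ε i,
        ‖inner ℂ ψ (tensor fun i : Fin k => if (i : ℕ) < b then posVec (ω i)
          else momVec (ω i))‖ ^ 2 := by
  classical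
  rw [husimiSquare, ← Fintype.sum_prod_type', ← (digitsEquiv k b hbk).sum_comp,
    ← Finset.sum_filter]
  simp only [mem_square_iff b hb hb' hbk, husimi, coherent_digitsEquiv]
  refine Finset.sum_congr ?_ fun _ _ => rfl
  ext ω
  simp

variable [NeZero k]

theorem inner_Psi (η : Fin k → Bool) (m b : ℕ) (ω : Fin k → Fin 3) :
    inner ℂ (Psi η m) (tensor fun i : Fin k => if (i : ℕ) < b then posVec (ω i)
      else momVec (ω i)) =
    (1 / (Real.sqrt (normalization η m) : ℂ)) * ∑ j ∈ Finset.range (period η),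
      conj (c η m j) * ∏ i : Fin k, amp b i (ext η (i + j)) (ω i) := by
  rw [Psi, inner_smul_left, sum_inner]
  congr 1
  · simp
  · refine Finset.sum_congr rfl fun j _ => ?_
    rw [inner_smul_left, ket, inner_tensor]
    simp only [tau_iterate_apply, amp]

theorem husimiSquare_Psi (η : Fin k → Bool) (m b : ℕ) (hb : v ≤ b) (hb' : v ≤ k - b) (hbk : b ≤ k)
    (ε' ε : Fin v → Fin 3) :
    (husimiSquare b hb hb' (Psi η m) ε' ε : ℂ) = (normalization η m : ℂ)⁻¹ *
      ∑ j ∈ Finset.range (period η), ∑ j' ∈ Finset.range (period η),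
        conj (c η m j) * c η m j' * kernel η b ε' ε j j' := by
  have hN : (Real.sqrt (normalization η m) : ℂ) ^ 2 = normalization η m :=
    ofReal_sqrt_sq (normalization_pos η m).le
  have hterm : ∀ ω : Fin k → Fin 3,
      ((‖inner ℂ (Psi η m) (tensor fun i : Fin k => if (i : ℕ) < b then posVec (ω i)
        else momVec (ω i))‖ ^ 2 : ℝ) : ℂ) = (normalization η m : ℂ)⁻¹ *
      ∑ j ∈ Finset.range (period η), ∑ j' ∈ Finset.range (period η),
        conj (c η m j) * c η m j' * ∏ i : Fin k,
          (amp b i (ext η (i + j)) (ω i) * conj (amp b i (ext η (i + j')) (ω i))) := by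
    intro ω
    rw [inner_Psi, Complex.ofReal_pow, ← Complex.mul_conj', map_mul, map_sum, mul_mul_mul_comm,
      Finset.sum_mul_sum]
    congr 1
    · rw [map_div₀, map_one, Complex.conj_ofReal, ← hN]
      ring
    · refine Finset.sum_congr rfl fun j _ => Finset.sum_congr rfl fun j' _ => ?_
      rw [map_mul, Complex.conj_conj, map_prod, Finset.prod_mul_distrib]
      ring
  rw [husimiSquare_eq_sum b hb hb' hbk, Complex.ofReal_sum]
  simp only [hterm]
  rw [← Finset.mul_sum, Finset.sum_comm]
  congr 1
  refine Finset.sum_congr rfl fun j _ => ?_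
  rw [Finset.sum_comm]
  refine Finset.sum_congr rfl fun j' _ => ?_
  rw [← Finset.mul_sum, kernel]
  congr 1
  simp only [localKernel]
  -- The strings in the square form a product set, so the sum of products factors.
  exact (Finset.prod_univ_sum (fun i : Fin k => allowed k ε' ε i) fun i a =>
    amp b i (ext η (i + j)) a * conj (amp b i (ext η (i + j')) a)).symm

theorem rho_eq (η : Fin k → Bool) (m b : ℕ) (hb : v ≤ b) (hb' : v ≤ k - b) (hk : 2 * v ≤ k)
    (ε' ε : Fin v → Fin 3) :
    (rho η ε' ε : ℂ) = (normalization η m : ℂ)⁻¹ * ∑ j ∈ Finset.range (period η),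
      conj (c η m j) * c η m j * kernel η b ε' ε j j := by
  have hc : ∀ j, conj (c η m j) * c η m j = ((‖c η 0 j‖ ^ 2 : ℝ) : ℂ) := fun j => by
    rw [Complex.conj_mul', norm_c, norm_c, Complex.ofReal_pow]
  simp only [hc, kernel_self η b hb hb' ε' ε hk]
  rw [normalization_eq η m, rho, nu]
  norm_cast
  rw [mul_left_comm, Finset.mul_sum]
  congr 1
  exact Finset.sum_congr rfl fun j _ => by ring

open Classical in
theorem abs_husimiSquare_sub_rho_le (η : Fin k → Bool) (m b : ℕ) (hb : v ≤ b) (hb' : v ≤ k - b)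
    (hbk : b ≤ k) (ε' ε : Fin v → Fin 3) :
    |husimiSquare b hb hb' (Psi η m) ε' ε - rho η ε' ε| ≤ (normalization η m)⁻¹ *
      ∑ j ∈ Finset.range (period η), ∑ j' ∈ Finset.range (period η),
        (if j ≠ j' ∧ Agree η v j j' then ‖c η m j‖ * ‖c η m j'‖ else 0) := by
  rw [← Real.norm_eq_abs, ← Complex.norm_real, Complex.ofReal_sub,
    husimiSquare_Psi η m b hb hb' hbk, rho_eq η m b hb hb' (by omega), ← mul_sub,
    ← Finset.sum_sub_distrib, norm_mul, norm_inv, Complex.norm_real,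
    Real.norm_of_nonneg (normalization_pos η m).le]
  refine mul_le_mul_of_nonneg_left ?_ (inv_nonneg.2 (normalization_pos η m).le)
  refine norm_sum_le_of_le _ fun j hj => ?_
  -- The term j' = j cancels against ρ on the left and is 0 on the right.
  rw [← Finset.add_sum_erase _ _ hj, add_sub_cancel_left, ← Finset.add_sum_erase _ (fun j' =>
    if j ≠ j' ∧ Agree η v j j' then ‖c η m j‖ * ‖c η m j'‖ else 0) hj, if_neg (by simp), zero_add]
  refine norm_sum_le_of_le _ fun j' hj' => ?_
  have hne := (Finset.mem_erase.1 hj').1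
  split_ifs with h
  · rw [norm_mul, norm_mul, RCLike.norm_conj]
    exact mul_le_of_le_one_right (by positivity) (norm_kernel_le_one ..)
  · rw [kernel_eq_zero b ε' ε fun hag => h ⟨hne.symm, hag⟩, mul_zero, norm_zero]

end Expansion

end WalshBaker

theorem theorem3 (v : ℕ) (hv : 0 < v) :
    ∃ C : ℝ, ∀ (ε' ε : Fin v → Fin 3) (k : ℕ) [NeZero k] (η : Fin k → Bool) (m : ℕ) (_ : m < k)
      (b : ℕ) (hb : v ≤ b) (hb' : v ≤ k - b),
      |WalshBaker.husimiSquare b hb hb' (WalshBaker.Psi η m) ε' ε - WalshBaker.rho η ε' ε|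
        ≤ C / (k : ℝ) := by
  refine ⟨32 * (v : ℝ) ^ 2 * ‖WalshBaker.lam‖ ^ (-(2 * WalshBaker.discBound v)), ?_⟩
  intro ε' ε k _ η m _ b hb hb'
  have hN := WalshBaker.normalization_pos η m
  refine (WalshBaker.abs_husimiSquare_sub_rho_le η m b hb hb' (by omega) ε' ε).trans ?_
  rw [inv_mul_le_iff₀ hN, mul_comm (WalshBaker.normalization η m)]
  exact WalshBaker.sum_agree_le η v m (by omega)
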